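/- Theorem (MTBFA lower bound). Let $P$ be a Markov kernel on a measurable space $\mathbb X$ satisfying Doeblin's condition: there are a probability measure $\phi$ on $\mathbb X$, a number $\lambda>0$ and an integer $l\ge 1$ such that $P^l(x,A)\ge\lambda\,\phi(A)$ for all $x\in\mathbb X$ and all measurable $A$. Let $r\ge 1$ be an integer. Then there is a constant $\alpha_1>0$ such that the following holds. Let $\pi$ be an invariant probability measure of $P$ and $F_P=\pi\otimes P$, i.e. $F_P(A\times B)=\int_A P(x,B)\,\pi(dx)$. Let $k:\mathbb X^2\times\mathbb X^2\to\mathbb R$ be a measurable positive definite kernel (symmetric, $\sum_{i,j}c_ic_jk(z_i,z_j)\ge 0$) with $|k|\le 1$, with reproducing kernel Hilbert space $\mathcal H_k$, and let $\mu_P=\int k(z,\cdot)\,F_P(dz)$. Let $(X_i)$ and $(Y_i)$ be independent stationary Markov chains on a common probability space, both with kernel $P$ and initial law $\pi$ (no change occurs, $Q=P$); here $(X_i)_{i\ge 1}$ is the reference data, and $(Y_t)_{t\ge -r}$ is the observed process. Put $\tilde X_i=(X_i,X_{i+1})$, $\tilde Y_i=(Y_i,Y_{i+1})$. Let $\Sigma_{\tilde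 X},\Sigma_{\tilde Y}$ be real numbers such that $\sum_{t=1}^n\rho_t\le\Sigma$ for all $n$, with $\Sigma=\Sigma_{\tilde X}$ and $\Sigma=\Sigma_{\tilde Y}$ respectively, where $\rho_t=\bigl|\mathbb E\langle k(Z_t,\cdot)-\mu_P,\,k(Z_0,\cdot)-\mu_P\rangle_{\mathcal H_k}\bigr|$ for the stationary pair process $(Z_t)$ in question ($\tilde X$, respectively $\tilde Y$, indexed from its first pair). Let $m\ge 1$ and $M,\tau\ge 0$ be integers. For $t\ge 0$ let $B_t=(Y_{t-r},\dots,Y_t)$ be the buffer at time $t$ and $$s(B_t)=\sqrt{\frac1{r^2}\sum_{i,j=t-r}^{t-1}k(\tilde Y_i,\tilde Y_j)+\frac1{m^2}\sum_{i,j=1}^{m}k(\tilde X_i,\tilde X_j)-\frac2{mr}\sum_{i=t-r}^{t-1}\sum_{j=1}^{m}k(\tilde Y_i,\tilde X_j)}-\sqrt{\frac{1+\Sigma_{\tilde X}}m}-\sqrt{\frac{1+\Sigma_{\tilde Y}}r},$$ $$S_{j:n}=\sum_{t=j}^{n}s(B_t),\qquad \hat S_n=\max_{1\le j\le n-M}S_{j:n}\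 \ (-\infty\text{ if } n\le M),\qquad T(b,M)=\inf\{n\in\mathbb N:\hat S_n\ge b\}\in\mathbb N\cup\{\infty\}.$$ Then the mean time between false alarms $\mathrm{MTBFA}(T)=\mathbb E[T-\tau\mid T>\tau]$ (for $\tau=0$ this is $\mathbb E[T]$) satisfies, for all sufficiently large $b$, $$\mathrm{MTBFA}(T(b,M))\ \ge\ M-1+(b-\alpha_1)(1+o(1)),$$ where $o(1)$ is a function of $b$ that tends to $0$ as $b\to\infty$ with all other data fixed. -/

import Mathlib

open MeasureTheory ProbabilityTheory Filter Topology
open scoped ENNReal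

noncomputable section

namespace KernelCusum

/-- Doeblin's condition: `P^l (x, ·) ≥ lam • φ` for all `x`, for some probability measure `φ`,
some `lam > 0` and some integer `l ≥ 1`. -/
def Doeblin {S : Type*} [MeasurableSpace S] (P : Kernel S S) : Prop :=
  ∃ (φ : Measure S) (lam : ℝ) (l : ℕ), IsProbabilityMeasure φ ∧ 0 < lam ∧ 1 ≤ l ∧
    ∀ x : S, ∀ A : Set S, MeasurableSet A → ENNReal.ofReal lam * φ A ≤ (P ^ l) x A

/-- `X` is a Markov chain (with respect to its own history) under `μ` with transition kernel `P`
and initial law `ν`: the joint law of `(X 0, …, X n)` and `X (n + 1)` is obtained by drawing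
`X (n + 1)` from `P (X n, ·)`. -/
structure IsMarkovChain {Ω S : Type*} [MeasurableSpace Ω] [MeasurableSpace S]
    (μ : Measure Ω) (P : Kernel S S) (ν : Measure S) (X : ℕ → Ω → S) : Prop where
  measurable : ∀ i, Measurable (X i)
  initial : μ.map (X 0) = ν
  step : ∀ n : ℕ,
    μ.map (fun ω => ((fun i : Fin (n + 1) => X i ω), X (n + 1) ω)) =
      (μ.map (fun ω => fun i : Fin (n + 1) => X i ω)) ⊗ₘ
        (P.comap (fun h : Fin (n + 1) → S => h (Fin.last n)) (measurable_pi_apply _))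

/-- The inner product `⟨k(x, ·) - μ_F, k(y, ·) - μ_F⟩` in the reproducing kernel Hilbert space of
`k`, where `μ_F = ∫ k(z, ·) dF(z)` is the mean embedding of `F`, expanded through the reproducing
property (see `inner_sub_embedding`). -/
def centeredKernel {Z : Type*} [MeasurableSpace Z] (k : Z → Z → ℝ) (F : Measure Z) (x y : Z) : ℝ :=
  k x y - (∫ z, k x z ∂F) - (∫ z, k z y ∂F) + ∫ z, ∫ w, k z w ∂F ∂F

/-- `centeredKernel` is the inner product of centered features, for every feature map `Φ` of `k`
into an inner product space and every mean embedding `e` of `F`. -/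
theorem inner_sub_embedding {Z H : Type*} [MeasurableSpace Z] [NormedAddCommGroup H]
    [InnerProductSpace ℝ H] (k : Z → Z → ℝ) (F : Measure Z) (Φ : Z → H) (e : H)
    (hΦ : ∀ x y, inner ℝ (Φ x) (Φ y) = k x y)
    (he : ∀ h : H, inner ℝ e h = ∫ z, inner ℝ (Φ z) h ∂F) (x y : Z) :
    inner ℝ (Φ x - e) (Φ y - e) = centeredKernel k F x y := by
  have h1 : inner ℝ (Φ x) e = ∫ z, k x z ∂F := by
    rw [real_inner_comm, he]
    exact integral_congr_ae (ae_of_all _ fun z => by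
      show inner ℝ (Φ z) (Φ x) = k x z
      rw [real_inner_comm, hΦ])
  have h2 : inner ℝ e (Φ y) = ∫ z, k z y ∂F := by
    rw [he]; simp only [hΦ]
  have h3 : inner ℝ e e = ∫ z, ∫ w, k z w ∂F ∂F := by
    rw [he]
    refine integral_congr_ae (ae_of_all _ fun z => ?_)
    show inner ℝ (Φ z) e = ∫ w, k z w ∂F
    rw [real_inner_comm, he]
    exact integral_congr_ae (ae_of_all _ fun w => by
      show inner ℝ (Φ w) (Φ z) = k z w
      rw [real_inner_comm, hΦ])
  rw [inner_sub_left, inner_sub_right, inner_sub_right, hΦ, h1, h2, h3, centeredKernel]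
  ring

/-- The weak dependence coefficient
`ρ_t = |E ⟨k(Z_t, ·) - μ_F, k(Z_0, ·) - μ_F⟩|` of a process `(Z_t)` with marginal law `F`. -/
def weakDep {Ω Z : Type*} [MeasurableSpace Ω] [MeasurableSpace Z] (μ : Measure Ω)
    (k : Z → Z → ℝ) (F : Measure Z) (Zt : ℕ → Ω → Z) (t : ℕ) : ℝ :=
  |∫ ω, centeredKernel k F (Zt t ω) (Zt 0 ω) ∂μ|

/-- The process is weakly dependent with constant `sig`: `ρ_1 + … + ρ_n ≤ sig` for all `n`. -/
def WeaklyDependent {Ω Z : Type*} [MeasurableSpace Ω] [MeasurableSpace Z] (μ : Measure Ω)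
    (k : Z → Z → ℝ) (F : Measure Z) (Zt : ℕ → Ω → Z) (sig : ℝ) : Prop :=
  ∀ n : ℕ, ∑ t ∈ Finset.Icc 1 n, weakDep μ k F Zt t ≤ sig

/-- The second order process `(X_i, X_{i+1})`. -/
def secondOrder {Ω S : Type*} (X : ℕ → Ω → S) (i : ℕ) (ω : Ω) : S × S := (X i ω, X (i + 1) ω)

/-- The `n` consecutive pairs contained in a block of `n + 1` observations. -/
def pairs {S : Type*} {n : ℕ} (B : Fin (n + 1) → S) (i : Fin n) : S × S :=
  (B i.castSucc, B i.succ)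

/-- The MMD `γ_k` between the empirical measures of two samples. -/
def empiricalMMD {Z : Type*} (k : Z → Z → ℝ) {r m : ℕ} (y : Fin r → Z) (x : Fin m → Z) : ℝ :=
  √((1 / (r : ℝ) ^ 2) * ∑ i, ∑ j, k (y i) (y j) + (1 / (m : ℝ) ^ 2) * ∑ i, ∑ j, k (x i) (x j)
    - (2 / ((m : ℝ) * (r : ℝ))) * ∑ i, ∑ j, k (y i) (x j))

/-- The estimation error bound subtracted from the empirical MMD. -/
def errorBound (m r : ℕ) (sigX sigY : ℝ) : ℝ := √((1 + sigX) / m) + √((1 + sigY) / r)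

/-- The score `s(B)` of a buffer `B` of `r + 1` observations, relative to the reference
block `x` of `m + 1` observations. -/
def score {S : Type*} (k : S × S → S × S → ℝ) (sigX sigY : ℝ) {m r : ℕ}
    (x : Fin (m + 1) → S) (B : Fin (r + 1) → S) : ℝ :=
  empiricalMMD k (pairs B) (pairs x) - errorBound m r sigX sigY

/-- The buffer at time `t` for an observed path `y`. The observations are numbered so that `y j` is
the one made at time `j - r`; hence the buffer holds the observations made at times `t - r, …, t`
and is already full at time `0`. -/
def buffer {S : Type*} (r : ℕ) (y : ℕ → S) (t : ℕ) : Fin (r + 1) → S := fun j => y (t + j)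

/-- `S_{k:n}`, the sum of the scores from time `k` to time `n`. -/
def cusum (s : ℕ → ℝ) (k n : ℕ) : ℝ := ∑ t ∈ Finset.Icc k n, s t

/-- `max_{1 ≤ k ≤ n - M} S_{k:n}`, equal to `-∞` if there is no such `k`, i.e. if `n ≤ M`. -/
def testStatistic (s : ℕ → ℝ) (M n : ℕ) : EReal :=
  ⨆ k ∈ Finset.Icc 1 (n - M), ((cusum s k n : ℝ) : EReal)

/-- The stopping time `T(b, M)`: the first `n` at which the test statistic reaches `b`
(`∞` if there is none). -/
def stoppingTime (s : ℕ → ℝ) (b : ℝ) (M : ℕ) : ℕ∞ :=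
  ⨅ (n : ℕ) (_ : (b : EReal) ≤ testStatistic s M n), (n : ℕ∞)

/-- The kernel CUSUM stopping time `T(b, M)` computed from the reference process `X` (of which the
first `m + 1` observations are used) and the observed process `Y`. -/
def kernelCusumTime {Ω S : Type*} (k : S × S → S × S → ℝ) (sigX sigY : ℝ) (m r : ℕ)
    (X Y : ℕ → Ω → S) (b : ℝ) (M : ℕ) (ω : Ω) : ℕ∞ :=
  stoppingTime
    (fun t => score k sigX sigY (fun i : Fin (m + 1) => X i ω) (buffer r (fun j => Y j ω) t)) b M

/-- The mean time between false alarms `E[T - τ | T > τ]`, for `μ` a law without change.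
For `τ = 0` and `T > 0` this is `E[T]`. -/
def mtbfa {Ω : Type*} [MeasurableSpace Ω] (μ : Measure Ω) (T : Ω → ℕ∞) (τ : ℕ) : ℝ≥0∞ :=
  ∫⁻ ω, ((T ω - (τ : ℕ∞) : ℕ∞) : ℝ≥0∞) ∂(ProbabilityTheory.cond μ {ω | (τ : ℕ∞) < T ω})

end KernelCusum

end

/-! The heart of the matter is `E[T] ≥ b - 1` with constants independent of `M` and `τ`. As these
are fixed while `b → ∞`, the loss of `M + τ` is absorbed by the `o(1)` term, and `α₁ = 1` works. Let
`e` be the error bound subtracted in the score. If `e ≥ 1`, then scores are at most `2 - e ≤ 1`,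
since the MMD is at most 2, so an alarm takes at least `b` steps on every path. If `e ≤ 1`, the
score is controlled in mean. Let `D` be the empirical MMD. Then `(D - e)⁺ ≤ D² / (4e)`, and `E[D²] ≤
2e²` by stationarity, independence of the two chains and weak dependence (`integral_sqMMD_le`), so
the positive part has mean at most `e / 2 ≤ 1 / 2` (`integral_max_scoreProcess_le`). An alarm by
time `n` forces the positive parts to sum to `b`, so Markov's inequality gives `P(T ≤ n) ≤ n /
(2b)`. Summing `P(T > n)` over `n < ⌊2b⌋` yields the bound
(`ofReal_sub_one_le_lintegral_stoppingTime`). Finally, scores are below 2, so `T > τ` surely once `b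
> 2τ`: conditioning is then vacuous and only `τ` is subtracted. -/

namespace KernelCusum

/-! ### Stationarity of the chain and of its process of pairs. -/

section MarkovChain

variable {Ω S : Type*} [MeasurableSpace Ω] [MeasurableSpace S] {μ : Measure Ω}
  {P : Kernel S S} {π : Measure S} {X X' : ℕ → Ω → S}

/-- Pushing forward the conditioning variable of a composition-product along `g`, when the kernel
depends on that variable only through `g`. -/
theorem map_compProd_comap {A B C : Type*} [MeasurableSpace A] [MeasurableSpace B]
    [MeasurableSpace C] (ν : Measure A) [SFinite ν] (κ : Kernel B C) [IsSFiniteKernel κ]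
    {g : A → B} (hg : Measurable g) :
    (ν ⊗ₘ κ.comap g hg).map (Prod.map g id) = (ν.map g) ⊗ₘ κ := by
  ext s hs
  rw [Measure.map_apply (hg.prodMap measurable_id) hs,
    Measure.compProd_apply ((hg.prodMap measurable_id) hs), Measure.compProd_apply hs,
    lintegral_map (Kernel.measurable_kernel_prodMk_left hs) hg]
  rfl

theorem IsMarkovChain.isProbabilityMeasure [IsProbabilityMeasure π]
    (h : IsMarkovChain μ P π X) : IsProbabilityMeasure μ := by
  have h1 : IsProbabilityMeasure (μ.map (X 0)) := h.initial ▸ inferInstance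
  exact (Measure.isProbabilityMeasure_map_iff (h.measurable 0).aemeasurable).1 h1

/-- The law of the first transition. -/
theorem IsMarkovChain.map_zero_one [IsProbabilityMeasure π] [IsMarkovKernel P]
    (h : IsMarkovChain μ P π X) : μ.map (fun ω => (X 0 ω, X 1 ω)) = π ⊗ₘ P := by
  have := h.isProbabilityMeasure
  have hX := h.measurable
  have hb : Measurable fun ω => fun i : Fin (0 + 1) => X i ω :=
    measurable_pi_lambda _ fun i => hX i
  have := Measure.isProbabilityMeasure_map (μ := μ) hb.aemeasurable
  have e := congrArg (Measure.map (Prod.map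
    (fun h : Fin (0 + 1) → S => h (Fin.last 0)) id)) (h.step 0)
  rw [map_compProd_comap, Measure.map_map (by fun_prop) (by fun_prop),
    Measure.map_map (by fun_prop) (by fun_prop)] at e
  rw [← h.initial]
  exact e

/-- A Markov chain started from an invariant law, shifted by one step, is again such a chain. -/
theorem IsMarkovChain.tail [IsProbabilityMeasure π] [IsMarkovKernel P]
    (hπ : Kernel.Invariant P π) (h : IsMarkovChain μ P π X) :
    IsMarkovChain μ P π fun i => X (i + 1) where
  measurable i := h.measurable (i + 1)
  initial := by
    have hX := h.measurable
    have e := congrArg Measure.snd h.map_zero_one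
    rw [Measure.snd_compProd, hπ.def, Measure.snd, Measure.map_map (by fun_prop) (by fun_prop)] at e
    exact e
  step n := by
    have := h.isProbabilityMeasure
    have hX := h.measurable
    have hb : Measurable fun ω => fun i : Fin (n + 1 + 1) => X i ω :=
      measurable_pi_lambda _ fun i => hX i
    have := Measure.isProbabilityMeasure_map (μ := μ) hb.aemeasurable
    let g : (Fin (n + 1 + 1) → S) → Fin (n + 1) → S := fun x i => x i.succ
    have hg : Measurable g := measurable_pi_lambda _ fun i => measurable_pi_apply _
    have e := congrArg (Measure.map (Prod.map g id)) (h.step (n + 1))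
    -- The transition reads only the last coordinate, which survives dropping the first one.
    have hk : P.comap (fun h : Fin (n + 1 + 1) → S => h (Fin.last (n + 1)))
          (measurable_pi_apply _) =
        (P.comap (fun h : Fin (n + 1) → S => h (Fin.last n)) (measurable_pi_apply _)).comap
          g hg := by
      ext x s hs
      rfl
    rw [hk, map_compProd_comap, Measure.map_map (hg.prodMap measurable_id) (by fun_prop),
      Measure.map_map hg hb] at e
    exact e

theorem IsMarkovChain.shift [IsProbabilityMeasure π] [IsMarkovKernel P]
    (hπ : Kernel.Invariant P π) (h : IsMarkovChain μ P π X) (a : ℕ) :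
    IsMarkovChain μ P π fun i => X (a + i) := by
  induction a with
  | zero => simpa using h
  | succ a ih =>
    convert ih.tail hπ using 2 with i
    ring_nf

/-- The finite dimensional laws of a Markov chain are determined by the transition kernel and the
initial law. -/
theorem IsMarkovChain.map_block_eq (h : IsMarkovChain μ P π X) (h' : IsMarkovChain μ P π X')
    (n : ℕ) : μ.map (fun ω => fun i : Fin (n + 1) => X i ω) =
      μ.map (fun ω => fun i : Fin (n + 1) => X' i ω) := by
  have hX := h.measurable
  have hX' := h'.measurable
  induction n with
  | zero =>
    have hc : Measurable fun (x : S) (_ : Fin (0 + 1)) => x :=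
      measurable_pi_lambda _ fun _ => measurable_id
    have e := congrArg (Measure.map fun (x : S) (_ : Fin (0 + 1)) => x)
      (h.initial.trans h'.initial.symm)
    rw [Measure.map_map hc (hX 0), Measure.map_map hc (hX' 0)] at e
    convert e using 2 <;> · ext ω i; simp
  | succ n ih =>
    have e : μ.map (fun ω => ((fun i : Fin (n + 1) => X i ω), X (n + 1) ω)) =
        μ.map (fun ω => ((fun i : Fin (n + 1) => X' i ω), X' (n + 1) ω)) := by
      rw [h.step, h'.step, ih]
    -- Appending the new state to the block turns the law given by `step` into the law of the longer
    -- block.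
    let g : (Fin (n + 1) → S) × S → Fin (n + 1 + 1) → S :=
      fun x => Fin.snoc (α := fun _ => S) x.1 x.2
    have hg : Measurable g := by
      refine measurable_pi_lambda _ fun i => ?_
      refine Fin.lastCases ?_ (fun i => ?_) i
      · simpa [g] using measurable_snd
      · simp only [g, Fin.snoc_castSucc]
        fun_prop
    have e2 := congrArg (Measure.map g) e
    rw [Measure.map_map hg (by fun_prop), Measure.map_map hg (by fun_prop)] at e2
    convert e2 using 2 <;>
    · ext ω i
      refine Fin.lastCases ?_ (fun i => ?_) i <;> simp [g]

theorem measurable_secondOrder (hX : ∀ i, Measurable (X i)) (i : ℕ) :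
    Measurable (secondOrder X i) := (hX i).prodMk (hX (i + 1))

/-- The marginal laws of the process of pairs. -/
theorem IsMarkovChain.map_secondOrder [IsProbabilityMeasure π] [IsMarkovKernel P]
    (hπ : Kernel.Invariant P π) (h : IsMarkovChain μ P π X) (i : ℕ) :
    μ.map (secondOrder X i) = π ⊗ₘ P :=
  (h.shift hπ i).map_zero_one

/-- The process of pairs is stationary: the joint law of two terms depends only on the lag. -/
theorem IsMarkovChain.map_secondOrder_prod [IsProbabilityMeasure π] [IsMarkovKernel P]
    (hπ : Kernel.Invariant P π) (h : IsMarkovChain μ P π X) (a t : ℕ) :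
    μ.map (fun ω => (secondOrder X (a + t) ω, secondOrder X a ω)) =
      μ.map (fun ω => (secondOrder X t ω, secondOrder X 0 ω)) := by
  have hX := h.measurable
  let g : (Fin (t + 1 + 1) → S) → (S × S) × (S × S) :=
    fun x => ((x ⟨t, by omega⟩, x ⟨t + 1, by omega⟩), (x ⟨0, by omega⟩, x ⟨1, by omega⟩))
  have hg : Measurable g := by fun_prop
  have e := congrArg (Measure.map g) ((h.shift hπ a).map_block_eq h (t + 1))
  rw [Measure.map_map hg (measurable_pi_lambda _ fun i => hX _),
    Measure.map_map hg (measurable_pi_lambda _ fun i => hX _)] at e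
  exact e

end MarkovChain

/-! ### Pathwise lower bounds on the stopping time. -/

section Deterministic

/-- The sum of the positive parts of the scores dominates the test statistic. -/
theorem testStatistic_le (s : ℕ → ℝ) (M n : ℕ) :
    testStatistic s M n ≤ ((∑ t ∈ Finset.Icc 1 n, max (s t) 0 : ℝ) : EReal) := by
  refine iSup₂_le fun j hj => EReal.coe_le_coe_iff.2 ?_
  calc cusum s j n ≤ ∑ t ∈ Finset.Icc j n, max (s t) 0 :=
        Finset.sum_le_sum fun t _ => le_max_left _ _
    _ ≤ ∑ t ∈ Finset.Icc 1 n, max (s t) 0 :=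
        Finset.sum_le_sum_of_subset_of_nonneg
          (Finset.Icc_subset_Icc_left (Finset.mem_Icc.1 hj).1) fun t _ _ => le_max_right _ _

/-- An alarm by time `n` requires that the positive parts of the scores add up to `b`. -/
theorem le_sum_of_stoppingTime_le {s : ℕ → ℝ} {b : ℝ} {M n : ℕ}
    (h : stoppingTime s b M ≤ n) : b ≤ ∑ t ∈ Finset.Icc 1 n, max (s t) 0 := by
  -- A strict bound on the infimum produces an actual alarm time `j ≤ n`.
  have h1 : stoppingTime s b M < ((n + 1 : ℕ) : ℕ∞) :=
    h.trans_lt (by exact_mod_cast Nat.lt_succ_self n)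
  obtain ⟨j, hj⟩ := iInf_lt_iff.1 h1
  obtain ⟨hj, hjn⟩ := iInf_lt_iff.1 hj
  have hjn : j ≤ n := Nat.lt_succ_iff.1 (by exact_mod_cast hjn)
  exact (EReal.coe_le_coe_iff.1 (hj.trans (testStatistic_le s M j))).trans
    (Finset.sum_le_sum_of_subset_of_nonneg (Finset.Icc_subset_Icc_right hjn)
      fun t _ _ => le_max_right _ _)

theorem lt_stoppingTime {s : ℕ → ℝ} {c b : ℝ} {M n : ℕ} (hc : 0 ≤ c) (hs : ∀ t, s t ≤ c)
    (hb : n * c < b) : (n : ℕ∞) < stoppingTime s b M := by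
  by_contra! h
  have h1 := le_sum_of_stoppingTime_le h
  have h2 : ∑ t ∈ Finset.Icc 1 n, max (s t) 0 ≤ ∑ t ∈ Finset.Icc 1 n, c :=
    Finset.sum_le_sum fun t _ => max_le (hs t) hc
  simp at h2
  linarith

/-- If the scores are at most one, there is no alarm before time `b`. -/
theorem ofReal_le_stoppingTime {s : ℕ → ℝ} {b : ℝ} {M : ℕ} (hs : ∀ t, s t ≤ 1) :
    ENNReal.ofReal b ≤ (stoppingTime s b M : ℝ≥0∞) := by
  cases h : stoppingTime s b M using ENat.recTopCoe with
  | top => simp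
  | coe n =>
    have : ¬ (n * 1 < b) := fun hb => by
      have := lt_stoppingTime (M := M) zero_le_one hs hb
      simp [h] at this
    rw [ENat.toENNReal_coe, ← ENNReal.ofReal_natCast]
    exact ENNReal.ofReal_le_ofReal (by linarith)

/-- A pointwise lower bound on the stopping time, linear in the scores' positive parts. -/
theorem ofReal_sum_le_stoppingTime {s : ℕ → ℝ} {b : ℝ} {M : ℕ} (hb : 0 < b) (N : ℕ) :
    ENNReal.ofReal (∑ n ∈ Finset.range N, (1 - (∑ t ∈ Finset.Icc 1 n, max (s t) 0) / b)) ≤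
      (stoppingTime s b M : ℝ≥0∞) := by
  cases h : stoppingTime s b M using ENat.recTopCoe with
  | top => simp
  | coe T =>
    rw [ENat.toENNReal_coe, ← ENNReal.ofReal_natCast]
    refine ENNReal.ofReal_le_ofReal ?_
    -- The pathwise form of Markov's inequality: `1 - G_n / b ≤ 1{n < T}`, where `G_n` is the sum of
    -- positive parts. Summing the indicators counts at most `T`.
    calc _ ≤ ∑ n ∈ Finset.range N, if n < T then (1 : ℝ) else 0 := by
          refine Finset.sum_le_sum fun n _ => ?_
          have h0 : 0 ≤ ∑ t ∈ Finset.Icc 1 n, max (s t) 0 :=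
            Finset.sum_nonneg fun t _ => le_max_right _ _
          split_ifs with hn
          · have := div_nonneg h0 hb.le
            linarith
          · have h1 : b ≤ ∑ t ∈ Finset.Icc 1 n, max (s t) 0 :=
              le_sum_of_stoppingTime_le (M := M) (by rw [h]; exact_mod_cast not_lt.1 hn)
            have := (one_le_div hb).2 h1
            linarith
      _ ≤ T := by
          rw [← Finset.sum_filter, Finset.sum_const, nsmul_eq_mul, mul_one]
          have : (Finset.range N).filter (· < T) ⊆ Finset.range T := fun n hn => by
            simp at hn ⊢
            exact hn.2
          exact_mod_cast (Finset.card_le_card this).trans_eq (Finset.card_range T)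

end Deterministic

/-! ### Bounds on the squared empirical MMD. -/

section MMD

variable {Z : Type*} {k : Z → Z → ℝ}

theorem kernel_symm (hk : (Matrix.of k).PosSemidef) (z w : Z) : k z w = k w z := by
  simpa using (hk.isHermitian.apply w z)

/-- The radicand in `empiricalMMD`. -/
noncomputable def sqMMD (k : Z → Z → ℝ) {r m : ℕ} (y : Fin r → Z) (x : Fin m → Z) : ℝ :=
  (1 / (r : ℝ) ^ 2) * ∑ i, ∑ j, k (y i) (y j) + (1 / (m : ℝ) ^ 2) * ∑ i, ∑ j, k (x i) (x j)
    - (2 / ((m : ℝ) * (r : ℝ))) * ∑ i, ∑ j, k (y i) (x j)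

/-- This is the quadratic form of `k` on the pooled sample, with weights `1/r` on `y` and `-1/m` on
`x`. -/
theorem sqMMD_nonneg (hk : (Matrix.of k).PosSemidef) {r m : ℕ} (y : Fin r → Z) (x : Fin m → Z) :
    0 ≤ sqMMD k y x := by
  have h := (hk.submatrix (Sum.elim y x)).dotProduct_mulVec_nonneg
    (Sum.elim (fun _ => (1 : ℝ) / r) fun _ => -((1 : ℝ) / m))
  simp only [dotProduct, Matrix.mulVec, Fintype.sum_sum_type, Sum.elim_inl, Sum.elim_inr,
    Matrix.submatrix_apply, Matrix.of_apply, Pi.star_apply, star_trivial] at h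
  have hc : ∑ i, ∑ j, k (x i) (y j) = ∑ i, ∑ j, k (y i) (x j) := by
    rw [Finset.sum_comm]
    exact Finset.sum_congr rfl fun i _ => Finset.sum_congr rfl fun j _ => kernel_symm hk _ _
  simp only [mul_add, Finset.sum_add_distrib, ← Finset.mul_sum, ← Finset.sum_mul, hc] at h
  refine h.trans_eq ?_
  unfold sqMMD
  ring

theorem abs_double_sum_le (hk : ∀ z w, |k z w| ≤ 1) {r m : ℕ} (y : Fin r → Z) (x : Fin m → Z) :
    |∑ i, ∑ j, k (y i) (x j)| ≤ r * m := by
  calc |∑ i, ∑ j, k (y i) (x j)| ≤ ∑ i, ∑ j, |k (y i) (x j)| :=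
        (Finset.abs_sum_le_sum_abs _ _).trans
          (Finset.sum_le_sum fun i _ => Finset.abs_sum_le_sum_abs _ _)
    _ ≤ ∑ _i : Fin r, ∑ _j : Fin m, (1 : ℝ) :=
        Finset.sum_le_sum fun i _ => Finset.sum_le_sum fun j _ => hk _ _
    _ = r * m := by simp

theorem sqMMD_le_four (hk : ∀ z w, |k z w| ≤ 1) {r m : ℕ} (hr : 1 ≤ r) (hm : 1 ≤ m)
    (y : Fin r → Z) (x : Fin m → Z) : sqMMD k y x ≤ 4 := by
  have hr' : (0 : ℝ) < r := by exact_mod_cast hr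
  have hm' : (0 : ℝ) < m := by exact_mod_cast hm
  have h1 : (1 / (r : ℝ) ^ 2) * ∑ i, ∑ j, k (y i) (y j) ≤ 1 := by
    rw [one_div, inv_mul_le_iff₀ (by positivity)]
    linarith [(le_abs_self _).trans (abs_double_sum_le hk y y)]
  have h2 : (1 / (m : ℝ) ^ 2) * ∑ i, ∑ j, k (x i) (x j) ≤ 1 := by
    rw [one_div, inv_mul_le_iff₀ (by positivity)]
    linarith [(le_abs_self _).trans (abs_double_sum_le hk x x)]
  have h3 : -((2 / ((m : ℝ) * (r : ℝ))) * ∑ i, ∑ j, k (y i) (x j)) ≤ 2 := by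
    rw [← mul_neg, div_mul_eq_mul_div, div_le_iff₀ (by positivity)]
    linarith [(neg_le_abs _).trans (abs_double_sum_le hk y x)]
  unfold sqMMD
  linarith

theorem empiricalMMD_le_two (hk : ∀ z w, |k z w| ≤ 1) {r m : ℕ} (hr : 1 ≤ r) (hm : 1 ≤ m)
    (y : Fin r → Z) (x : Fin m → Z) : empiricalMMD k y x ≤ 2 :=
  Real.sqrt_le_iff.2 ⟨by norm_num, (sqMMD_le_four hk hr hm y x).trans_eq (by norm_num)⟩

/-- The positive part of the score is dominated by a multiple of the squared MMD. -/
theorem max_sub_le_sqMMD (hk : (Matrix.of k).PosSemidef) {r m : ℕ} (y : Fin r → Z)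
    (x : Fin m → Z) {e : ℝ} (he : 0 < e) :
    max (empiricalMMD k y x - e) 0 ≤ sqMMD k y x / (4 * e) := by
  have h : empiricalMMD k y x ^ 2 = sqMMD k y x := Real.sq_sqrt (sqMMD_nonneg hk y x)
  rw [← h]
  refine max_le ?_ (by positivity)
  rw [le_div_iff₀ (by positivity)]
  -- Tangent line to the parabola: `4e(D - e) ≤ D²`, with equality at `D = 2e`.
  nlinarith [sq_nonneg (empiricalMMD k y x - 2 * e)]

end MMD

/-! ### Expectations of the kernel, and summation over lags. -/

section SecondMoment

variable {Ω Z : Type*} [MeasurableSpace Ω] [MeasurableSpace Z] {μ : Measure Ω}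
  [IsProbabilityMeasure μ] {k : Z → Z → ℝ} {F : Measure Z} [IsProbabilityMeasure F]

theorem integrable_kernel_comp (hkm : Measurable (Function.uncurry k))
    (hkb : ∀ z w, |k z w| ≤ 1) {U V : Ω → Z} (hU : Measurable U) (hV : Measurable V) :
    Integrable (fun ω => k (U ω) (V ω)) μ :=
  Integrable.of_bound (C := 1) (hkm.comp (hU.prodMk hV)).aestronglyMeasurable
    (ae_of_all _ fun _ => hkb _ _)

theorem measurable_integral_kernel (hkm : Measurable (Function.uncurry k)) :
    Measurable fun z => ∫ w, k z w ∂F :=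
  (hkm.stronglyMeasurable.integral_prod_right (ν := F)).measurable

theorem abs_integral_kernel_le (hkb : ∀ z w, |k z w| ≤ 1) (z : Z) : |∫ w, k z w ∂F| ≤ 1 := by
  simpa using norm_integral_le_of_norm_le_const (μ := F) (f := k z) (ae_of_all _ (hkb z))

/-- If `U` and `V` have law `F`, centering the kernel subtracts the constant `∬ k dF dF` from the
expectation of `k(U, V)`. -/
theorem integral_centeredKernel_comp (hkm : Measurable (Function.uncurry k))
    (hk : (Matrix.of k).PosSemidef) (hkb : ∀ z w, |k z w| ≤ 1) {U V : Ω → Z}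
    (hU : Measurable U) (hV : Measurable V) (hUF : μ.map U = F) (hVF : μ.map V = F) :
    ∫ ω, centeredKernel k F (U ω) (V ω) ∂μ =
      ∫ ω, k (U ω) (V ω) ∂μ - ∫ z, ∫ w, k z w ∂F ∂F := by
  have hm := measurable_integral_kernel (F := F) hkm
  have hint : ∀ {W : Ω → Z}, Measurable W → Integrable (fun ω => ∫ w, k (W ω) w ∂F) μ :=
    fun hW => Integrable.of_bound (C := 1) (hm.comp hW).aestronglyMeasurable
      (ae_of_all _ fun ω => abs_integral_kernel_le hkb _)
  have hE : ∀ {W : Ω → Z}, Measurable W → μ.map W = F →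
      ∫ ω, ∫ w, k (W ω) w ∂F ∂μ = ∫ z, ∫ w, k z w ∂F ∂F := fun hW hWF => by
    have := integral_map (μ := μ) hW.aemeasurable (f := fun z => ∫ w, k z w ∂F)
      hm.aestronglyMeasurable
    rw [hWF] at this
    exact this.symm
  -- By symmetry both partial means are the same function, so each contributes one double integral:
  -- `-1 - 1 + 1 = -1`.
  have hs : ∀ v, ∫ z, k z v ∂F = ∫ w, k v w ∂F := fun v => by
    simp_rw [kernel_symm hk v]
  simp only [centeredKernel, hs]
  have hkI := integrable_kernel_comp (μ := μ) hkm hkb hU hV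
  have hkU := hkI.sub (hint hU)
  rw [integral_add (by exact hkU.sub (hint hV)) (integrable_const _),
    integral_sub (by exact hkU) (hint hV), integral_sub hkI (hint hU), hE hU hUF, hE hV hVF]
  simp

theorem integral_kernel_le_one (hkm : Measurable (Function.uncurry k))
    (hkb : ∀ z w, |k z w| ≤ 1) {U V : Ω → Z} (hU : Measurable U) (hV : Measurable V) :
    ∫ ω, k (U ω) (V ω) ∂μ ≤ 1 := by
  have := integral_mono (integrable_kernel_comp (μ := μ) hkm hkb hU hV) (integrable_const (1 : ℝ))
    fun ω => (abs_le.1 (hkb (U ω) (V ω))).2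
  simpa using this

theorem neg_one_le_double_integral_kernel (hkb : ∀ z w, |k z w| ≤ 1) :
    -1 ≤ ∫ z, ∫ w, k z w ∂F ∂F := by
  have h : |∫ z, ∫ w, k z w ∂F ∂F| ≤ 1 := by
    simpa using norm_integral_le_of_norm_le_const (μ := F) (f := fun z => ∫ w, k z w ∂F)
      (ae_of_all _ fun z => abs_integral_kernel_le (F := F) hkb z)
  exact (abs_le.1 h).1

theorem integral_kernel_indep (hkm : Measurable (Function.uncurry k))
    (hkb : ∀ z w, |k z w| ≤ 1) {U V : Ω → Z} (hU : Measurable U) (hV : Measurable V)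
    (hUF : μ.map U = F) (hVF : μ.map V = F) (h : IndepFun U V μ) :
    ∫ ω, k (U ω) (V ω) ∂μ = ∫ z, ∫ w, k z w ∂F ∂F := by
  have h1 := (indepFun_iff_map_prod_eq_prod_map_map hU.aemeasurable hV.aemeasurable).1 h
  rw [hUF, hVF] at h1
  have h2 := integral_map (μ := μ) (hU.prodMk hV).aemeasurable (f := Function.uncurry k)
    hkm.aestronglyMeasurable
  rw [h1, integral_prod _ (Integrable.of_bound (C := 1) hkm.aestronglyMeasurable
    (ae_of_all _ fun p => hkb _ _))] at h2
  exact h2.symm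

/-- The lags to a fixed index, on both sides, contribute at most `2 σ`. -/
theorem sum_lag_le {c : ℕ → ℕ → ℝ} {ρ : ℕ → ℝ} {d sig : ℝ}
    (hsig : ∀ n, ∑ t ∈ Finset.Icc 1 n, ρ t ≤ sig) (hd : ∀ i, c i i ≤ d)
    (hc : ∀ i t, 1 ≤ t → c (i + t) i ≤ ρ t ∧ c i (i + t) ≤ ρ t) {n i : ℕ} (hi : i < n) :
    ∑ j ∈ Finset.range n, c i j ≤ d + 2 * sig := by
  have hρ : ∀ n, ∑ t ∈ Finset.range n, ρ (t + 1) ≤ sig := fun n => by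
    have h : Finset.Icc 1 n = Finset.Ico (0 + 1) (n + 1) := by
      ext
      simp only [Finset.mem_Icc, Finset.mem_Ico]
      omega
    have := hsig n
    rwa [h, ← Finset.sum_Ico_add' ρ 0 n 1, ← Finset.range_eq_Ico] at this
  rw [← Finset.sum_range_add_sum_Ico _ hi.le, Finset.sum_eq_sum_Ico_succ_bot hi]
  have h1 : ∑ j ∈ Finset.range i, c i j ≤ sig := by
    refine le_trans ?_ (hρ i)
    -- Reversed, the `j`-th term has lag `j + 1` to `i`.
    rw [← Finset.sum_range_reflect]
    refine Finset.sum_le_sum fun j hj => ?_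
    have hj := Finset.mem_range.1 hj
    have := (hc (i - 1 - j) (j + 1) (by omega)).1
    rwa [show i - 1 - j + (j + 1) = i by omega] at this
  have h2 : ∑ j ∈ Finset.Ico (i + 1) n, c i j ≤ sig := by
    refine le_trans ?_ (hρ (n - (i + 1)))
    rw [Finset.sum_Ico_eq_sum_range]
    refine Finset.sum_le_sum fun j _ => ?_
    have := (hc i (j + 1) (by omega)).2
    rwa [show i + (j + 1) = i + 1 + j by omega] at this
  linarith [hd i]

end SecondMoment

/-- The empty sum, `n = 0`, already forces this. -/
theorem WeaklyDependent.nonneg {Ω Z : Type*} [MeasurableSpace Ω] [MeasurableSpace Z]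
    {μ : Measure Ω} {k : Z → Z → ℝ} {F : Measure Z}
    {Zt : ℕ → Ω → Z} {sig : ℝ} (h : WeaklyDependent μ k F Zt sig) : 0 ≤ sig := by
  simpa using h 0

/-! ### Second moment of the MMD between two independent stationary chains. -/

section Chains

variable {Ω S : Type*} [MeasurableSpace Ω] [MeasurableSpace S] {μ : Measure Ω}
  [IsProbabilityMeasure μ] {P : Kernel S S} [IsMarkovKernel P] {π : Measure S}
  [IsProbabilityMeasure π] {k : S × S → S × S → ℝ} {X Y : ℕ → Ω → S} {sigX sigY : ℝ}

/-- Stationarity moves the two pairs to indices `t` and `0`, where the difference is the expected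
centered kernel, whose absolute value is the coefficient. -/
theorem IsMarkovChain.integral_kernel_lag_le (hπ : Kernel.Invariant P π)
    (hkm : Measurable (Function.uncurry k)) (hk : (Matrix.of k).PosSemidef)
    (hkb : ∀ z w, |k z w| ≤ 1) (hX : IsMarkovChain μ P π X) (a t : ℕ) :
    ∫ ω, k (secondOrder X (a + t) ω) (secondOrder X a ω) ∂μ
      - ∫ z, ∫ w, k z w ∂(π ⊗ₘ P) ∂(π ⊗ₘ P) ≤ weakDep μ k (π ⊗ₘ P) (secondOrder X) t := by
  have hZ := measurable_secondOrder hX.measurable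
  have e1 := integral_map (μ := μ) ((hZ (a + t)).prodMk (hZ a)).aemeasurable
    (f := Function.uncurry k) hkm.aestronglyMeasurable
  have e2 := integral_map (μ := μ) ((hZ t).prodMk (hZ 0)).aemeasurable
    (f := Function.uncurry k) hkm.aestronglyMeasurable
  rw [hX.map_secondOrder_prod hπ a t] at e1
  have e3 := e1.symm.trans e2
  simp only [Function.uncurry_apply_pair] at e3
  rw [e3, ← integral_centeredKernel_comp hkm hk hkb (hZ t) (hZ 0) (hX.map_secondOrder hπ t)
    (hX.map_secondOrder hπ 0)]
  exact le_abs_self _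

/-- The variance bound for the empirical mean embedding of `n` consecutive pairs. -/
theorem IsMarkovChain.sum_integral_kernel_le (hπ : Kernel.Invariant P π)
    (hkm : Measurable (Function.uncurry k)) (hk : (Matrix.of k).PosSemidef)
    (hkb : ∀ z w, |k z w| ≤ 1) (hX : IsMarkovChain μ P π X)
    (hsig : WeaklyDependent μ k (π ⊗ₘ P) (secondOrder X) sigX) (a n : ℕ) :
    ∑ i : Fin n, ∑ j : Fin n, ∫ ω, k (secondOrder X (a + i) ω) (secondOrder X (a + j) ω) ∂μ ≤
      n ^ 2 * ∫ z, ∫ w, k z w ∂(π ⊗ₘ P) ∂(π ⊗ₘ P) + n * (2 * (1 + sigX)) := by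
  have hZ := measurable_secondOrder hX.measurable
  set C := ∫ z, ∫ w, k z w ∂(π ⊗ₘ P) ∂(π ⊗ₘ P) with hC
  let c : ℕ → ℕ → ℝ := fun i j =>
    ∫ ω, k (secondOrder X (a + i) ω) (secondOrder X (a + j) ω) ∂μ - C
  have hrow : ∀ i : Fin n, ∑ j : Fin n, c i j ≤ 2 + 2 * sigX := fun i => by
    rw [Fin.sum_univ_eq_sum_range (c i) n]
    refine sum_lag_le (ρ := weakDep μ k (π ⊗ₘ P) (secondOrder X)) hsig (fun i => ?_)
      (fun i t _ => ⟨?_, ?_⟩) i.2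
    · have h1 := integral_kernel_le_one (μ := μ) hkm hkb (hZ (a + i)) (hZ (a + i))
      have h2 := neg_one_le_double_integral_kernel (F := π ⊗ₘ P) hkb
      simp only [c]
      linarith
    · simpa only [c, add_assoc] using hX.integral_kernel_lag_le hπ hkm hk hkb (a + i) t
    · have h := hX.integral_kernel_lag_le hπ hkm hk hkb (a + i) t
      simp only [c, ← add_assoc]
      simpa only [kernel_symm hk (secondOrder X (a + i + t) _)] using h
  have hsum : ∑ i : Fin n, ∑ j : Fin n, c i j ≤ ∑ _i : Fin n, (2 + 2 * sigX) :=
    Finset.sum_le_sum fun i _ => hrow i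
  simp only [c, Finset.sum_sub_distrib, Finset.sum_const, Finset.card_univ, Fintype.card_fin,
    nsmul_eq_mul] at hsum
  linarith

/-- The squared MMD between `r` consecutive pairs of `Y` and `m` consecutive pairs of `X`. -/
theorem integral_sqMMD_le (hπ : Kernel.Invariant P π)
    (hkm : Measurable (Function.uncurry k)) (hk : (Matrix.of k).PosSemidef)
    (hkb : ∀ z w, |k z w| ≤ 1) (hX : IsMarkovChain μ P π X) (hY : IsMarkovChain μ P π Y)
    (hXY : IndepFun (fun ω i => X i ω) (fun ω i => Y i ω) μ)
    (hsigX : WeaklyDependent μ k (π ⊗ₘ P) (secondOrder X) sigX)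
    (hsigY : WeaklyDependent μ k (π ⊗ₘ P) (secondOrder Y) sigY)
    {r m : ℕ} (hr : 1 ≤ r) (hm : 1 ≤ m) (t : ℕ) :
    ∫ ω, sqMMD k (fun i : Fin r => secondOrder Y (t + i) ω)
        (fun i : Fin m => secondOrder X (0 + i) ω) ∂μ ≤
      2 * ((1 + sigY) / r) + 2 * ((1 + sigX) / m) := by
  have hr' : (0 : ℝ) < r := by exact_mod_cast hr
  have hm' : (0 : ℝ) < m := by exact_mod_cast hm
  have hZX := measurable_secondOrder hX.measurable
  have hZY := measurable_secondOrder hY.measurable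
  have hI : ∀ {U V : Ω → S × S}, Measurable U → Measurable V →
      Integrable (fun ω => k (U ω) (V ω)) μ := integrable_kernel_comp hkm hkb
  have hIs : ∀ {p q : ℕ} {U V : ℕ → Ω → S × S}, (∀ i, Measurable (U i)) →
      (∀ i, Measurable (V i)) → ∀ a b, Integrable (fun ω => ∑ i : Fin p, ∑ j : Fin q,
        k (U (a + i) ω) (V (b + j) ω)) μ := fun hU hV a b =>
    integrable_finsetSum _ fun i _ => integrable_finsetSum _ fun j _ => hI (hU _) (hV _)
  have hEs : ∀ {p q : ℕ} {U V : ℕ → Ω → S × S}, (∀ i, Measurable (U i)) →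
      (∀ i, Measurable (V i)) → ∀ a b, ∫ ω, ∑ i : Fin p, ∑ j : Fin q,
        k (U (a + i) ω) (V (b + j) ω) ∂μ =
        ∑ i : Fin p, ∑ j : Fin q, ∫ ω, k (U (a + i) ω) (V (b + j) ω) ∂μ := fun hU hV a b => by
    rw [integral_finsetSum _ fun i _ => integrable_finsetSum _ fun j _ => hI (hU _) (hV _)]
    exact Finset.sum_congr rfl fun i _ => integral_finsetSum _ fun j _ => hI (hU _) (hV _)
  set C := ∫ z, ∫ w, k z w ∂(π ⊗ₘ P) ∂(π ⊗ₘ P) with hC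
  have hcross : ∀ i j, ∫ ω, k (secondOrder Y i ω) (secondOrder X j ω) ∂μ = C := fun i j => by
    refine integral_kernel_indep hkm hkb (hZY i) (hZX j) (hY.map_secondOrder hπ i)
      (hX.map_secondOrder hπ j) ?_
    exact hXY.symm.comp (φ := fun y => (y i, y (i + 1))) (ψ := fun x => (x j, x (j + 1)))
      (by fun_prop) (by fun_prop)
  have h1 := hY.sum_integral_kernel_le hπ hkm hk hkb hsigY t r
  have h2 := hX.sum_integral_kernel_le hπ hkm hk hkb hsigX 0 m
  simp only [sqMMD]
  rw [integral_sub
      (by exact ((hIs hZY hZY t t).const_mul _).add ((hIs hZX hZX 0 0).const_mul _))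
      ((hIs hZY hZX t 0).const_mul _),
    integral_add ((hIs hZY hZY t t).const_mul _) ((hIs hZX hZX 0 0).const_mul _),
    integral_const_mul, integral_const_mul, integral_const_mul, hEs hZY hZY, hEs hZX hZX,
    hEs hZY hZX]
  simp only [hcross, Finset.sum_const, Finset.card_univ, Fintype.card_fin, nsmul_eq_mul]
  -- The cross terms equal `C` exactly by independence, so the contributions `C + C - 2C` cancel and
  -- only the fluctuations remain.
  calc _ ≤ 1 / (r : ℝ) ^ 2 * (r ^ 2 * C + r * (2 * (1 + sigY))) +
        1 / (m : ℝ) ^ 2 * (m ^ 2 * C + m * (2 * (1 + sigX))) - 2 / (m * r) * (r * (m * C)) := by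
        gcongr
    _ = _ := by
        field_simp
        ring

end Chains

/-- Passing to the positive part lets `f` be negative, and monotonicity of the lower integral asks
no measurability of `g`. Hence the stopping time need not be shown measurable. -/
theorem ofReal_integral_le_lintegral {Ω : Type*} [MeasurableSpace Ω] {μ : Measure Ω}
    {f : Ω → ℝ} {g : Ω → ℝ≥0∞} (hf : Integrable f μ)
    (hfg : ∀ ω, ENNReal.ofReal (f ω) ≤ g ω) : ENNReal.ofReal (∫ ω, f ω ∂μ) ≤ ∫⁻ ω, g ω ∂μ := by
  calc ENNReal.ofReal (∫ ω, f ω ∂μ) ≤ ENNReal.ofReal (∫ ω, max (f ω) 0 ∂μ) :=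
        ENNReal.ofReal_le_ofReal (integral_mono hf hf.pos_part fun ω => le_max_left _ _)
    _ = ∫⁻ ω, ENNReal.ofReal (max (f ω) 0) ∂μ :=
        ofReal_integral_eq_lintegral_ofReal hf.pos_part (ae_of_all _ fun ω => le_max_right _ _)
    _ ≤ ∫⁻ ω, g ω ∂μ := lintegral_mono fun ω => by
        simpa [ENNReal.ofReal_max] using hfg ω

/-! ### From mean scores to the mean stopping time and the MTBFA. -/

section Expectation

variable {Ω : Type*} [MeasurableSpace Ω] {μ : Measure Ω} [IsProbabilityMeasure μ]

/-- If the positive parts of the scores have mean at most one half, the mean stopping time is at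
least `b - 1`. -/
theorem ofReal_sub_one_le_lintegral_stoppingTime {s : ℕ → Ω → ℝ}
    (hint : ∀ t, Integrable (s t) μ) (hs : ∀ t, ∫ ω, max (s t ω) 0 ∂μ ≤ 1 / 2)
    {b : ℝ} (hb : 0 < b) (M : ℕ) :
    ENNReal.ofReal (b - 1) ≤ ∫⁻ ω, (stoppingTime (fun t => s t ω) b M : ℝ≥0∞) ∂μ := by
  -- The lower bounds `1 - n / (2b)` are positive exactly for `n < 2b`, so the sum is cut there.
  set N := ⌊2 * b⌋₊ with hN
  have hG : ∀ n, Integrable (fun ω => ∑ t ∈ Finset.Icc 1 n, max (s t ω) 0) μ := fun n =>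
    integrable_finsetSum _ fun t _ => (hint t).pos_part
  have hterm : ∀ n, Integrable (fun ω => 1 - (∑ t ∈ Finset.Icc 1 n, max (s t ω) 0) / b) μ :=
    fun n => (integrable_const _).sub ((hG n).div_const b)
  refine le_trans (ENNReal.ofReal_le_ofReal ?_) (ofReal_integral_le_lintegral
    (integrable_finsetSum (Finset.range N) fun n _ => hterm n)
    fun ω => ofReal_sum_le_stoppingTime hb N)
  rw [integral_finsetSum _ fun n _ => hterm n]
  have hlow : ∀ n ∈ Finset.range N, 1 - (n : ℝ) / (2 * b) ≤
      ∫ ω, (1 - (∑ t ∈ Finset.Icc 1 n, max (s t ω) 0) / b) ∂μ := fun n _ => by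
    rw [integral_sub (integrable_const _) ((hG n).div_const b), integral_div,
      integral_finsetSum _ fun t _ => (hint t).pos_part]
    have h1 : ∑ t ∈ Finset.Icc 1 n, ∫ ω, max (s t ω) 0 ∂μ ≤ ∑ t ∈ Finset.Icc 1 n, (1 / 2 : ℝ) :=
      Finset.sum_le_sum fun t _ => hs t
    simp only [Finset.sum_const, Nat.card_Icc, nsmul_eq_mul, Nat.add_sub_cancel] at h1
    have h2 := div_le_div_of_nonneg_right h1 hb.le
    have h3 : (n : ℝ) * (1 / 2) / b = n / (2 * b) := by field_simp
    simp
    linarith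
  refine le_trans ?_ (Finset.sum_le_sum hlow)
  have hgauss : ∑ n ∈ Finset.range N, (n : ℝ) ≤ N * N / 2 := by
    have h := Finset.sum_range_id_mul_two N
    have h' : (∑ n ∈ Finset.range N, (n : ℝ)) * 2 ≤ N * N := by
      have h2 : (∑ n ∈ Finset.range N, n) * 2 ≤ N * N :=
        h.trans_le (Nat.mul_le_mul_left _ (Nat.sub_le _ _))
      simpa using (Nat.cast_le (α := ℝ)).2 h2
    linarith
  rw [Finset.sum_sub_distrib, ← Finset.sum_div]
  simp only [Finset.sum_const, Finset.card_range, nsmul_eq_mul]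
  have hN1 : (N : ℝ) ≤ 2 * b := Nat.floor_le (by positivity)
  have hN2 : 2 * b < N + 1 := Nat.lt_floor_add_one _
  -- The total is then at least `N - N / 2 = N / 2 > b - 1 / 2`.
  have hN4 : (N : ℝ) * (N / (4 * b)) ≤ N * (1 / 2) := by
    refine mul_le_mul_of_nonneg_left ?_ (Nat.cast_nonneg N)
    rw [div_le_iff₀ (by positivity)]
    linarith
  have hg' := div_le_div_of_nonneg_right hgauss (by positivity : (0 : ℝ) ≤ 2 * b)
  have : (N : ℝ) * N / 2 / (2 * b) = N * (N / (4 * b)) := by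
    field_simp
    ring
  linarith

/-- The conditioning event is the whole space, so conditioning changes nothing and the delay costs
at most `τ`. -/
theorem ofReal_le_mtbfa {T : Ω → ℕ∞} {τ : ℕ} {c : ℝ} (hT : ∀ ω, (τ : ℕ∞) < T ω)
    (hc : ENNReal.ofReal c ≤ ∫⁻ ω, (T ω : ℝ≥0∞) ∂μ) :
    ENNReal.ofReal (c - τ) ≤ mtbfa μ T τ := by
  have hu : {ω | (τ : ℕ∞) < T ω} = Set.univ := Set.eq_univ_of_forall hT
  rw [mtbfa, hu, cond_univ, ENNReal.ofReal_sub _ (Nat.cast_nonneg τ), ENNReal.ofReal_natCast,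
    tsub_le_iff_right]
  calc ENNReal.ofReal c ≤ ∫⁻ ω, (T ω : ℝ≥0∞) ∂μ := hc
    _ ≤ ∫⁻ ω, (((T ω - (τ : ℕ∞) : ℕ∞) : ℝ≥0∞) + τ) ∂μ := lintegral_mono fun ω => by
        rw [ENat.toENNReal_sub, ENat.toENNReal_coe]
        exact le_tsub_add
    _ = _ := by
        rw [lintegral_add_right _ measurable_const]
        simp

end Expectation

theorem errorBound_pos {m r : ℕ} {sigX sigY : ℝ} (hm : 1 ≤ m) (hX : 0 ≤ sigX) :
    0 < errorBound m r sigX sigY := by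
  have hm' : (0 : ℝ) < m := by exact_mod_cast hm
  have : 0 < √((1 + sigX) / m) := Real.sqrt_pos.2 (by positivity)
  exact add_pos_of_pos_of_nonneg this (Real.sqrt_nonneg _)

/-- The square of a sum of two square roots, with the nonnegative cross term dropped. -/
theorem add_le_errorBound_sq {m r : ℕ} {sigX sigY : ℝ} (hX : 0 ≤ sigX) (hY : 0 ≤ sigY) :
    (1 + sigY) / r + (1 + sigX) / m ≤ errorBound m r sigX sigY ^ 2 := by
  have h1 := Real.sq_sqrt (show 0 ≤ (1 + sigX) / m by positivity)
  have h2 := Real.sq_sqrt (show 0 ≤ (1 + sigY) / r by positivity)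
  have h3 := mul_nonneg (Real.sqrt_nonneg ((1 + sigX) / m)) (Real.sqrt_nonneg ((1 + sigY) / r))
  unfold errorBound
  nlinarith

/-! ### The score as a random variable. -/

section Score

variable {Ω S : Type*} {k : S × S → S × S → ℝ} {X Y : ℕ → Ω → S} {sigX sigY : ℝ}

theorem score_le {r m : ℕ} (hkb : ∀ z w, |k z w| ≤ 1) (hr : 1 ≤ r) (hm : 1 ≤ m)
    (x : Fin (m + 1) → S) (B : Fin (r + 1) → S) :
    score k sigX sigY x B ≤ 2 - errorBound m r sigX sigY :=
  sub_le_sub_right (empiricalMMD_le_two hkb hr hm _ _) _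

/-- The score of the buffer at time `t`, as a random variable. -/
noncomputable def scoreProcess (k : S × S → S × S → ℝ) (sigX sigY : ℝ) (m r : ℕ)
    (X Y : ℕ → Ω → S) (t : ℕ) (ω : Ω) : ℝ :=
  score k sigX sigY (fun i : Fin (m + 1) => X i ω) (buffer r (fun j => Y j ω) t)

/-- The offset `0 + i` gives the reference block the same shape as the buffer at `t + i`, so the
second-moment lemmas cover both. -/
theorem scoreProcess_eq (m r t : ℕ) (ω : Ω) :
    scoreProcess k sigX sigY m r X Y t ω =
      √(sqMMD k (fun i : Fin r => secondOrder Y (t + i) ω)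
        (fun i : Fin m => secondOrder X (0 + i) ω)) - errorBound m r sigX sigY := by
  simp only [zero_add]
  rfl

end Score

/-! ### Mean score without a change, and the bound on the mean alarm time. -/

section MeanScore

variable {Ω S : Type*} [MeasurableSpace Ω] [MeasurableSpace S] {μ : Measure Ω}
  [IsProbabilityMeasure μ] {P : Kernel S S} [IsMarkovKernel P] {π : Measure S}
  [IsProbabilityMeasure π] {k : S × S → S × S → ℝ} {X Y : ℕ → Ω → S} {sigX sigY : ℝ}

theorem measurable_sqMMD (hkm : Measurable (Function.uncurry k)) (hX : ∀ i, Measurable (X i))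
    (hY : ∀ i, Measurable (Y i)) (m r t : ℕ) :
    Measurable fun ω => sqMMD k (fun i : Fin r => secondOrder Y (t + i) ω)
        (fun i : Fin m => secondOrder X (0 + i) ω) := by
  have hZX := measurable_secondOrder hX
  have hZY := measurable_secondOrder hY
  have hI : ∀ {U V : Ω → S × S}, Measurable U → Measurable V →
      Measurable (fun ω => k (U ω) (V ω)) := fun hU hV => hkm.comp (hU.prodMk hV)
  have hs : ∀ {p q : ℕ} {U V : ℕ → Ω → S × S}, (∀ i, Measurable (U i)) →
      (∀ i, Measurable (V i)) → ∀ a b, Measurable (fun ω => ∑ i : Fin p, ∑ j : Fin q,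
        k (U (a + i) ω) (V (b + j) ω)) := fun hU hV a b =>
    Finset.measurable_fun_sum _ fun i _ => Finset.measurable_fun_sum _ fun j _ => hI (hU _) (hV _)
  exact (((hs hZY hZY t t).const_mul _).add ((hs hZX hZX 0 0).const_mul _)).sub
    ((hs hZY hZX t 0).const_mul _)

theorem integrable_sqMMD (hkm : Measurable (Function.uncurry k)) (hk : (Matrix.of k).PosSemidef)
    (hkb : ∀ z w, |k z w| ≤ 1) (hX : ∀ i, Measurable (X i))
    (hY : ∀ i, Measurable (Y i)) {m r : ℕ} (hr : 1 ≤ r) (hm : 1 ≤ m) (t : ℕ) :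
    Integrable (fun ω => sqMMD k (fun i : Fin r => secondOrder Y (t + i) ω)
        (fun i : Fin m => secondOrder X (0 + i) ω)) μ :=
  Integrable.of_bound (C := 4) (measurable_sqMMD hkm hX hY m r t).aestronglyMeasurable
    (ae_of_all _ fun ω => by
      rw [Real.norm_of_nonneg (sqMMD_nonneg hk _ _)]
      exact sqMMD_le_four hkb hr hm _ _)

theorem integrable_scoreProcess (hkm : Measurable (Function.uncurry k))
    (hkb : ∀ z w, |k z w| ≤ 1) (hX : ∀ i, Measurable (X i))
    (hY : ∀ i, Measurable (Y i)) {m r : ℕ} (hr : 1 ≤ r) (hm : 1 ≤ m) (t : ℕ) :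
    Integrable (scoreProcess k sigX sigY m r X Y t) μ := by
  simp only [funext (scoreProcess_eq (k := k) (sigX := sigX) (sigY := sigY) (X := X) (Y := Y) m r t)]
  refine Integrable.sub (Integrable.of_bound (C := 2)
    (measurable_sqMMD hkm hX hY m r t).sqrt.aestronglyMeasurable (ae_of_all _ fun ω => ?_))
    (integrable_const _)
  rw [Real.norm_of_nonneg (Real.sqrt_nonneg _)]
  exact empiricalMMD_le_two hkb hr hm _ _

/-- The mean of the positive part of the score is at most half the estimation error bound. -/
theorem integral_max_scoreProcess_le (hπ : Kernel.Invariant P π)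
    (hkm : Measurable (Function.uncurry k)) (hk : (Matrix.of k).PosSemidef)
    (hkb : ∀ z w, |k z w| ≤ 1) (hX : IsMarkovChain μ P π X) (hY : IsMarkovChain μ P π Y)
    (hXY : IndepFun (fun ω i => X i ω) (fun ω i => Y i ω) μ)
    (hsigX : WeaklyDependent μ k (π ⊗ₘ P) (secondOrder X) sigX)
    (hsigY : WeaklyDependent μ k (π ⊗ₘ P) (secondOrder Y) sigY)
    {r m : ℕ} (hr : 1 ≤ r) (hm : 1 ≤ m) (t : ℕ) :
    ∫ ω, max (scoreProcess k sigX sigY m r X Y t ω) 0 ∂μ ≤ errorBound m r sigX sigY / 2 := by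
  set e := errorBound m r sigX sigY with he
  have he0 : 0 < e := errorBound_pos hm hsigX.nonneg
  have h1 := integral_sqMMD_le hπ hkm hk hkb hX hY hXY hsigX hsigY hr hm t
  have h2 : (1 + sigY) / r + (1 + sigX) / m ≤ e ^ 2 :=
    add_le_errorBound_sq hsigX.nonneg hsigY.nonneg
  calc ∫ ω, max (scoreProcess k sigX sigY m r X Y t ω) 0 ∂μ ≤
        ∫ ω, sqMMD k (fun i : Fin r => secondOrder Y (t + i) ω)
          (fun i : Fin m => secondOrder X (0 + i) ω) / (4 * e) ∂μ := by
        refine integral_mono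
          (integrable_scoreProcess hkm hkb hX.measurable hY.measurable hr hm t).pos_part
          ((integrable_sqMMD hkm hk hkb hX.measurable hY.measurable hr hm t).div_const _)
          fun ω => ?_
        simp only [scoreProcess_eq]
        exact max_sub_le_sqMMD hk _ _ he0
    _ ≤ (2 * e ^ 2) / (4 * e) := by
        rw [integral_div]
        gcongr
        linarith
    _ = e / 2 := by
        field_simp
        ring

/-- Without a change, the mean of the kernel CUSUM stopping time is at least `b - 1`. -/
theorem ofReal_sub_one_le_lintegral_kernelCusumTime (hπ : Kernel.Invariant P π)
    (hkm : Measurable (Function.uncurry k)) (hk : (Matrix.of k).PosSemidef)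
    (hkb : ∀ z w, |k z w| ≤ 1) (hX : IsMarkovChain μ P π X) (hY : IsMarkovChain μ P π Y)
    (hXY : IndepFun (fun ω i => X i ω) (fun ω i => Y i ω) μ)
    (hsigX : WeaklyDependent μ k (π ⊗ₘ P) (secondOrder X) sigX)
    (hsigY : WeaklyDependent μ k (π ⊗ₘ P) (secondOrder Y) sigY)
    {r m : ℕ} (hr : 1 ≤ r) (hm : 1 ≤ m) (M : ℕ) {b : ℝ} (hb : 0 < b) :
    ENNReal.ofReal (b - 1) ≤
      ∫⁻ ω, (kernelCusumTime k sigX sigY m r X Y b M ω : ℝ≥0∞) ∂μ := by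
  -- A small error bound calls for the mean estimate; a large one caps every score at 1.
  rcases le_total (errorBound m r sigX sigY) 1 with he | he
  · exact ofReal_sub_one_le_lintegral_stoppingTime (s := scoreProcess k sigX sigY m r X Y)
      (integrable_scoreProcess hkm hkb hX.measurable hY.measurable hr hm)
      (fun t => (integral_max_scoreProcess_le hπ hkm hk hkb hX hY hXY hsigX hsigY hr hm t).trans
        (by linarith)) hb M
  · calc ENNReal.ofReal (b - 1) ≤ ENNReal.ofReal b := ENNReal.ofReal_le_ofReal (by linarith)
      _ = ∫⁻ _, ENNReal.ofReal b ∂μ := by simp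
      _ ≤ _ := lintegral_mono fun ω => ofReal_le_stoppingTime fun t =>
          (score_le hkb hr hm _ _).trans (by linarith)

end MeanScore

end KernelCusum

/-! ### The MTBFA lower bound. -/

theorem mainTheorem1 {S : Type*} [MeasurableSpace S]
    (P : Kernel S S) [IsMarkovKernel P] (hP : KernelCusum.Doeblin P)
    (r : ℕ) (hr : 1 ≤ r) :
    ∃ α₁ : ℝ, 0 < α₁ ∧
      ∀ {Ω : Type*} [MeasurableSpace Ω] (μ : Measure Ω) [IsProbabilityMeasure μ]
        (π : Measure S) [IsProbabilityMeasure π] (_hπ : Kernel.Invariant P π)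
        (k : S × S → S × S → ℝ) (_hk_meas : Measurable (Function.uncurry k))
        (_hk_psd : (Matrix.of k).PosSemidef) (_hk_bdd : ∀ z w, |k z w| ≤ 1)
        (X Y : ℕ → Ω → S)
        (_hX : KernelCusum.IsMarkovChain μ P π X) (_hY : KernelCusum.IsMarkovChain μ P π Y)
        (_hXY : IndepFun (fun ω i => X i ω) (fun ω i => Y i ω) μ)
        (sigX sigY : ℝ)
        (_hsigX : KernelCusum.WeaklyDependent μ k (π ⊗ₘ P) (KernelCusum.secondOrder X) sigX)
        (_hsigY : KernelCusum.WeaklyDependent μ k (π ⊗ₘ P) (KernelCusum.secondOrder Y) sigY)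
        (m : ℕ) (_hm : 1 ≤ m) (M τ : ℕ),
        ∃ g : ℝ → ℝ, Tendsto g atTop (𝓝 0) ∧
          ∀ᶠ b : ℝ in atTop,
            ENNReal.ofReal ((M : ℝ) - 1 + (b - α₁) * (1 + g b)) ≤
              KernelCusum.mtbfa μ (KernelCusum.kernelCusumTime k sigX sigY m r X Y b M) τ := by
  refine ⟨1, one_pos, ?_⟩
  intro Ω _ μ _ π _ hπ k hkm hk hkb X Y hX hY hXY sigX sigY hsigX hsigY m hm M τ
  -- Chosen so that the claimed bound becomes exactly `b - 1 - τ`.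
  refine ⟨fun b => (1 - τ - M) / (b - 1), ?_, ?_⟩
  · exact Tendsto.div_atTop tendsto_const_nhds (tendsto_atTop_add_const_right _ (-1) tendsto_id)
  -- The threshold `2τ` rules out an alarm by time `τ`, since each score is at most 2.
  · filter_upwards [eventually_gt_atTop (1 : ℝ), eventually_gt_atTop ((τ : ℝ) * 2)] with b hb1 hbτ
    have hb : (M : ℝ) - 1 + (b - 1) * (1 + (1 - τ - M) / (b - 1)) = b - 1 - τ := by
      have : b - 1 ≠ 0 := by linarith
      field_simp
      ring
    rw [hb]
    have he := KernelCusum.errorBound_pos (r := r) (sigY := sigY) hm hsigX.nonneg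
    exact KernelCusum.ofReal_le_mtbfa
      (fun ω => KernelCusum.lt_stoppingTime zero_le_two
        (fun t => (KernelCusum.score_le hkb hr hm _ _).trans (by linarith)) hbτ)
      (KernelCusum.ofReal_sub_one_le_lintegral_kernelCusumTime hπ hkm hk hkb hX hY hXY
        hsigX hsigY hr hm M (by linarith))
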